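/- Let $M$ be a compact connected Riemannian manifold with Riemannian distance $d_1$, let $(K,d_2)$ be a non-empty compact metric space, $\Sigma=M\times K$, and fix $\zeta\in(0,1]$. For a function $h$ on a metric space let $H_\zeta(h)=\sup_{x\ne y}|h(x)-h(y)|/d(x,y)^\zeta$. Let $F:\Sigma\to\Sigma$, $F(x,z)=(f(x),G(x,z))$, with $G:\Sigma\to K$ measurable and $f:M\to M$ a local diffeomorphism of degree $\deg(f)=\#f^{-1}(x)$. Let $m_1$ be an $f$-invariant Borel probability on $M$ such that $f$ has a Jacobian $J\ge 0$ with respect to $m_1$, i.e. $m_1(f(B))=\int_B J\,dm_1$ for every Borel set $B$ on which $f$ is injective, and put $\rho=1/|J|$. Let $x\mapsto L(x)$ be a continuous real function on $M$ such that every $x$ has a neighbourhood $U_x$ on which $f$ is injective and whose inverse branch satisfies $d_1(f_x^{-1}(y),f_x^{-1}(z))\le L(x)\,d_1(y,z)$ for $y,z\in f(U_x)$. Assume that there are an open set $\mathcal A\subset M$, constants $\sigma>1$, $1\le L\le 2$, $\epsilon_\rho>0$ and an integer $q\ge 0$ such that (f1) $L(x)\le L$ for $x\in\mathcal A$ and $L(x)<\sigma^{-1}$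 for $x\notin\mathcal A$; (f2) $M$ has a finite covering by open sets on each of which $f$ is injective, and $\mathcal A$ is covered by $q<\deg(f)$ of these sets; (f3) $\sup\log\rho-\inf\log\rho<\epsilon_\rho$ and $H_\zeta(\rho)<\epsilon_\rho\inf\rho$; and $$e^{\epsilon_\rho}\,\frac{(\deg(f)-q)\sigma^{-\zeta}+qL^{\zeta}[1+(L-1)^{\zeta}]}{\deg(f)}<1 .$$ Assume also (G1) there is $0<\alpha<1$ such that for $m_1$-a.e. $x\in M$, $d_2(G(x,z_1),G(x,z_2))\le\alpha\, d_2(z_1,z_2)$ for all $z_1,z_2\in K$. Let $\pi_x:\Sigma\to M$ be the projection. For a signed Borel measure $\mu=\mu^+-\mu^-$ (Jordan decomposition) on $\Sigma$ with $\pi_{x*}\mu^{\pm}\ll m_1$ put $\phi_x^\pm=d(\pi_{x*}\mu^\pm)/dm_1$, $\phi_x=\phi_x^+-\phi_x^-$, and let $\mu^\pm|_\gamma=\phi_x^\pm(\gamma)\,\mu^\pm_\gamma$, where $(\mu^\pm_\gamma)_{\gamma\in M}$ are the conditional probabilities on $K$ of the disintegration of $\mu^\pm$ along the fibres $\{\gamma\}\times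 K$. For finite measures on $K$ let $W_1^\zeta(\mu,\nu)=\sup\{|\int g\,d\mu-\int g\,d\nu| : H_\zeta(g)\le1,\ |g|_\infty\le1\}$. Let $S^\infty$ be the set of signed Borel measures $\mu$ on $\Sigma$ with $\pi_{x*}\mu^\pm\ll m_1$, with $\operatorname{ess\,sup}_{\gamma\in M} W_1^\zeta(\mu^+|_\gamma,\mu^-|_\gamma)<\infty$ (with respect to $m_1$), and such that $\phi_x$ coincides $m_1$-a.e. with a $\zeta$-Hölder function on $M$. Then there is exactly one $F$-invariant probability measure $\mu_0$ in $S^\infty$, and $\pi_{x*}\mu_0=m_1$. -/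

import Mathlib

open MeasureTheory Set
open scoped NNReal ENNReal Manifold ContDiff Topology Bundle

noncomputable section

namespace SkewProduct

section Base

variable {M : Type*}

/-- The degree `#f⁻¹(x)` of a map. For a local homeomorphism of a compact connected space the
cardinality of the fibre does not depend on the point, so one point is chosen. -/
def mapDegree [Nonempty M] (f : M → M) : ℕ :=
  (f ⁻¹' {Classical.arbitrary M}).ncard

/-- Around every `x` there is a neighbourhood `U` on which `f` is invertible onto its image, with
inverse branch Lipschitz of constant `L x`. The points of `f(U)` are written `f u`, `f v`. -/
def LocalInverseLipschitz [MetricSpace M] (f : M → M) (L : M → ℝ) : Prop :=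
  ∀ x, ∃ U ∈ 𝓝 x, InjOn f U ∧ ∀ u ∈ U, ∀ v ∈ U, dist u v ≤ L x * dist (f u) (f v)

/-- `J` is a Jacobian of `f` with respect to the measure `m`: `m (f A) = ∫_A J dm` for each
measurable set `A` on which `f` is injective. -/
structure IsJacobian [MeasurableSpace M] (f : M → M) (m : Measure M) (J : M → ℝ) : Prop where
  measurable : Measurable J
  nonneg : ∀ x, 0 ≤ J x
  image : ∀ A : Set M, MeasurableSet A → InjOn f A →
    m (f '' A) = ∫⁻ x in A, ENNReal.ofReal (J x) ∂m

/-- Condition on the expansion: `L(x) ≤ Λ` in the region `A` and `L(x) < σ⁻¹` outside. -/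
def CondF1 (L : M → ℝ) (A : Set M) (σ Λ : ℝ) : Prop :=
  (∀ x ∈ A, L x ≤ Λ) ∧ ∀ x ∈ Aᶜ, L x < σ⁻¹

/-- There is a finite covering of `M` by open domains of injectivity of `f`, such that `A` is
covered by `q < deg f` of these domains. -/
def CondF2 [TopologicalSpace M] [Nonempty M] (f : M → M) (A : Set M) (q : ℕ) : Prop :=
  q < mapDegree f ∧ ∃ 𝒰 : Finset (Set M),
    (∀ U ∈ 𝒰, IsOpen U ∧ InjOn f U) ∧ (⋃ U ∈ 𝒰, U) = univ ∧
    ∃ 𝒱 ⊆ 𝒰, 𝒱.card = q ∧ A ⊆ ⋃ U ∈ 𝒱, U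

/-- Small variation of the weight `ρ`: `sup log ρ - inf log ρ < ε` and `H_ζ(ρ) < ε inf ρ`. -/
def CondF3 [MetricSpace M] (ζ : ℝ≥0) (ρ : M → ℝ) (ε : ℝ) : Prop :=
  (⨆ x, Real.log (ρ x)) - (⨅ x, Real.log (ρ x)) < ε ∧
    eHolderNorm ζ ρ < ENNReal.ofReal (ε * ⨅ x, ρ x)

/-- The quantitative relation between the constants (`d` is the degree). -/
def CondConstants (ζ : ℝ≥0) (d q : ℕ) (σ Λ ε : ℝ) : Prop :=
  Real.exp ε *
    ((((d : ℝ) - q) * σ ^ (-(ζ : ℝ)) + q * Λ ^ (ζ : ℝ) * (1 + (Λ - 1) ^ (ζ : ℝ))) / d) < 1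

end Base

section Fibre

variable {M K : Type*}

/-- The skew product `F(x, z) = (f x, G(x, z))`. -/
def skew (f : M → M) (G : M × K → K) : M × K → M × K :=
  fun p => (f p.1, G p)

/-- `G` is uniformly contracting on `m`-almost every vertical fibre. -/
def CondG1 [MeasurableSpace M] [MetricSpace K] (m : Measure M) (G : M × K → K) : Prop :=
  ∃ α : ℝ, 0 < α ∧ α < 1 ∧
    ∀ᵐ x ∂m, ∀ z₁ z₂ : K, dist (G (x, z₁)) (G (x, z₂)) ≤ α * dist z₁ z₂

/-- The distance `sup |∫ g dμ - ∫ g dν|` over the functions `g` with `H_ζ(g) ≤ 1`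
and `|g|_∞ ≤ 1`. -/
def wDist [MetricSpace K] [MeasurableSpace K] (ζ : ℝ≥0) (μ ν : Measure K) : ℝ≥0∞ :=
  ⨆ (g : K → ℝ) (_ : HolderWith 1 ζ g) (_ : ∀ z, |g z| ≤ 1),
    ENNReal.ofReal |∫ z, g z ∂μ - ∫ z, g z ∂ν|

variable [MeasurableSpace M] [MeasurableSpace K]

/-- The restriction `μ|_x` of a positive measure to the fibre over `x`, as a measure on `K`:
the marginal density at `x` times the conditional probability given by the disintegration of `μ`
along the vertical fibres. -/
def fibreRestriction [StandardBorelSpace K] [Nonempty K] (m : Measure M)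
    (μ : Measure (M × K)) [IsFiniteMeasure μ] (x : M) : Measure K :=
  μ.fst.rnDeriv m x • μ.condKernel x

/-- The positive part of the Jordan decomposition. -/
abbrev posM (μ : SignedMeasure (M × K)) : Measure (M × K) :=
  μ.toJordanDecomposition.posPart

/-- The negative part of the Jordan decomposition. -/
abbrev negM (μ : SignedMeasure (M × K)) : Measure (M × K) :=
  μ.toJordanDecomposition.negPart

/-- Signed measures whose positive and negative parts have marginals absolutely continuous
with respect to `m`. -/
def AB (m : Measure M) : Set (SignedMeasure (M × K)) :=
  {μ | (posM μ).fst ≪ m ∧ (negM μ).fst ≪ m}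

/-- The marginal density `φ_x = φ_x⁺ - φ_x⁻`. -/
def marginalDensity (m : Measure M) (μ : SignedMeasure (M × K)) (x : M) : ℝ :=
  ((posM μ).fst.rnDeriv m x).toReal - ((negM μ).fst.rnDeriv m x).toReal

/-- The space `𝓛^∞`. -/
def LInfty [MetricSpace K] [StandardBorelSpace K] [Nonempty K] (m : Measure M) (ζ : ℝ≥0) :
    Set (SignedMeasure (M × K)) :=
  {μ | μ ∈ AB m ∧
    essSup (fun x => wDist ζ (fibreRestriction m (posM μ) x) (fibreRestriction m (negM μ) x)) m
      < ⊤}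

/-- The space `S^∞`: elements of `𝓛^∞` whose marginal density, a function defined `m`-almost
everywhere, is (has a representative that is) `ζ`-Hölder on `M`. -/
def SInfty [MetricSpace M] [MetricSpace K] [StandardBorelSpace K] [Nonempty K]
    (m : Measure M) (ζ : ℝ≥0) : Set (SignedMeasure (M × K)) :=
  {μ | μ ∈ LInfty m ζ ∧
    ∃ h : M → ℝ, (∃ C : ℝ≥0, HolderWith C ζ h) ∧ marginalDensity m μ =ᵐ[m] h}

end Fibre

end SkewProduct

end

/-! Base and fibre are treated separately. Iterates of `F` contract fibres at rate `α ^ n`, so the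
images of two probabilities with the same marginal merge weakly (`tendsto_integral_iterate_sub`).
Hence at most one invariant probability lies over `m₁`. One exists: consecutive images of `m₁ × δ`
under the iterates merge, so their weak limits are invariant. `F` need not be continuous;
`exists_continuous_integral_sub_le` replaces continuity, because all these measures have marginal
`m₁`.

It remains to see that an invariant probability in `S^∞` has marginal `m₁`
(`eq_of_continuous_density`). Its marginal has a continuous density `φ`, and invariance says that
`φ(y)` is the sum of `ρ φ` over the fibre of `y`, for `y` in the support of `m₁`; the density `1`
shows that the weights `ρ` sum to one there. Let `Z` be the set where `φ` attains its maximum on the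
support. `Z` is backward invariant, so the fibre sum of `u = dist(·, Z)` vanishes on `Z`. That sum
is Lipschitz with constant `c = (d - q)σ⁻¹ + qΛ`, being locally so on a length space; thus it is at
most `c u`. Since `ρ ≤ e^ε / d`, the weighted average of `u` is at most `(e^ε c / d) u`, with factor
below one by `CondConstants.linear`. Iterating the average on `max φ - φ ≤ η + C u` gives `max φ - φ
≤ η` for every `η > 0`, so `φ` is constant on the support (`eqOn_const_of_fixed`). -/

noncomputable section

namespace SkewProduct

/-! ### Measurability, and modification of `G` on a null set of fibres. -/

section Measurability

variable {M K : Type*} [MeasurableSpace M] [MeasurableSpace K]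

theorem measurable_skew {f : M → M} {G : M × K → K}
    (hf : Measurable f) (hG : Measurable G) : Measurable (skew f G) :=
  (hf.comp measurable_fst).prodMk hG

theorem fst_map_skew {f : M → M} (hf : Measurable f) {G : M × K → K} (hGm : Measurable G)
    (μ : Measure (M × K)) : (μ.map (skew f G)).fst = μ.fst.map f := by
  rw [Measure.fst, Measure.fst, Measure.map_map measurable_fst (measurable_skew hf hGm),
    Measure.map_map hf measurable_fst]
  rfl

theorem skew_ae_eq {f : M → M} {G G' : M × K → K} {m : Measure M} {μ : Measure (M × K)}
    (hμ : μ.fst = m) (h : ∀ᵐ x ∂m, ∀ z, G' (x, z) = G (x, z)) : skew f G' =ᵐ[μ] skew f G := by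
  rw [← hμ, Measure.fst] at h
  filter_upwards [ae_of_ae_map measurable_fst.aemeasurable h] with p hp
  exact Prod.ext rfl (hp p.2)

/-- A fibre map contracting on almost every fibre agrees with one contracting on every fibre. -/
theorem CondG1.exists_contract [MetricSpace K] [Nonempty K] {m : Measure M}
    {G : M × K → K} (hG : Measurable G)
    (h : CondG1 m G) : ∃ (G' : M × K → K) (α : ℝ), Measurable G' ∧ 0 ≤ α ∧ α < 1 ∧
      (∀ x z₁ z₂, dist (G' (x, z₁)) (G' (x, z₂)) ≤ α * dist z₁ z₂) ∧
      ∀ᵐ x ∂m, ∀ z, G' (x, z) = G (x, z) := by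
  classical
  obtain ⟨α, h0, h1, hae⟩ := h
  obtain ⟨z₀⟩ := ‹Nonempty K›
  obtain ⟨t, hsub, ht, hnull⟩ := exists_measurable_superset_of_null (ae_iff.1 hae)
  have hgood : ∀ x ∉ t, ∀ z₁ z₂ : K, dist (G (x, z₁)) (G (x, z₂)) ≤ α * dist z₁ z₂ := by
    intro x hx
    by_contra hcon
    exact hx (hsub hcon)
  -- On the fibres over the null set `t` the map becomes constant, hence contracting.
  refine ⟨fun p => if p.1 ∈ t then z₀ else G p, α,
    Measurable.ite (measurable_fst ht) measurable_const hG, h0.le, h1, fun x z₁ z₂ => ?_, ?_⟩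
  · by_cases hx : x ∈ t
    · simp only [hx, if_true, dist_self]; positivity
    · simpa only [hx, if_false] using hgood x hx z₁ z₂
  · filter_upwards [measure_eq_zero_iff_ae_notMem.1 hnull] with x hx z
    simp [hx]

/-- A family of continuous functions on a compact space which depends measurably on a parameter
pointwise is a measurable map to the space of continuous functions. -/
theorem measurable_curry_of_continuous {M K : Type*} [MeasurableSpace M] [MetricSpace K]
    [CompactSpace K] [Nonempty K] (Θ : M → C(K, ℝ))
    (hΘ : ∀ z, Measurable fun x => Θ x z) :
    StronglyMeasurable Θ := by
  borelize C(K, ℝ)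
  refine Measurable.stronglyMeasurable ?_
  have hball : ∀ (g : C(K, ℝ)) (r : ℝ), MeasurableSet {x | dist (Θ x) g ≤ r} := by
    intro g r
    have e : {x | dist (Θ x) g ≤ r} = ⋂ n : ℕ, {x | dist (Θ x (TopologicalSpace.denseSeq K n))
        (g (TopologicalSpace.denseSeq K n)) ≤ r} := by
      ext x
      simp only [mem_iInter]
      change dist (Θ x) g ≤ r ↔ ∀ n : ℕ, dist (Θ x (TopologicalSpace.denseSeq K n))
        (g (TopologicalSpace.denseSeq K n)) ≤ r
      rw [ContinuousMap.dist_le_iff_of_nonempty]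
      refine ⟨fun h n => h _, fun h z => ?_⟩
      have hc : IsClosed {z | dist (Θ x z) (g z) ≤ r} :=
        isClosed_le ((Θ x).continuous.dist g.continuous) continuous_const
      exact (TopologicalSpace.denseRange_denseSeq K).induction_on
        (p := fun z => dist (Θ x z) (g z) ≤ r) z hc h
    rw [e]
    exact MeasurableSet.iInter fun n =>
      measurableSet_le ((hΘ _).dist measurable_const) measurable_const
  have hdist : ∀ g : C(K, ℝ), Measurable fun x => dist (Θ x) g := fun g =>
    measurable_of_Iic fun r => hball g r
  refine measurable_of_isOpen fun O hO => ?_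
  -- `C(K, ℝ)` is second countable, so an open set is a countable union of balls.
  obtain ⟨s, hs, hO'⟩ := TopologicalSpace.isOpen_iUnion_countable
    (fun p : {p : C(K, ℝ) × ℝ // Metric.ball p.1 p.2 ⊆ O} => Metric.ball p.1.1 p.1.2)
    (fun _ => Metric.isOpen_ball)
  have e : O = ⋃ p ∈ s, Metric.ball p.1.1 p.1.2 := by
    rw [hO']
    refine Subset.antisymm (fun g hg => ?_) (iUnion_subset fun p => p.2)
    obtain ⟨r, hr, hr'⟩ := Metric.isOpen_iff.1 hO g hg
    exact mem_iUnion.2 ⟨⟨(g, r), hr'⟩, Metric.mem_ball_self hr⟩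
  rw [e, preimage_iUnion₂]
  exact MeasurableSet.biUnion hs fun p _ => measurableSet_lt (hdist _) measurable_const

theorem integral_comp_iterate {X : Type*} [TopologicalSpace X] [MeasurableSpace X] [BorelSpace X]
    {T : X → X} (hT : Measurable T) (μ : Measure X) (n : ℕ)
    {ψ : X → ℝ} (hψ : Continuous ψ) :
    ∫ p, ψ (T^[n] p) ∂μ = ∫ p, ψ p ∂(μ.map T^[n]) := by
  rw [integral_map (hT.iterate n).aemeasurable hψ.measurable.aestronglyMeasurable]

end Measurability

/-! ### Invariant probabilities over a given marginal. -/

section FibreContraction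

variable {M K : Type*}

theorem skew_iterate_contract [MetricSpace K] {f : M → M} {G : M × K → K} {α : ℝ} (hα : 0 ≤ α)
    (hG : ∀ x z₁ z₂, dist (G (x, z₁)) (G (x, z₂)) ≤ α * dist z₁ z₂) (n : ℕ) (x : M) (z₁ z₂ : K) :
    ((skew f G)^[n] (x, z₁)).1 = ((skew f G)^[n] (x, z₂)).1 ∧
      dist ((skew f G)^[n] (x, z₁)).2 ((skew f G)^[n] (x, z₂)).2 ≤ α ^ n * dist z₁ z₂ := by
  induction n with
  | zero => simp
  | succ n ih =>
    simp only [Function.iterate_succ_apply']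
    set p₁ := (skew f G)^[n] (x, z₁)
    set p₂ := (skew f G)^[n] (x, z₂)
    refine ⟨congrArg f ih.1, ?_⟩
    have h : dist (G (p₁.1, p₁.2)) (G (p₁.1, p₂.2)) ≤ α * dist p₁.2 p₂.2 := hG _ _ _
    have e : (p₁.1, p₂.2) = p₂ := Prod.ext ih.1 rfl
    rw [e] at h
    calc dist (skew f G p₁).2 (skew f G p₂).2 ≤ α * dist p₁.2 p₂.2 := h
      _ ≤ α * (α ^ n * dist z₁ z₂) := by gcongr; exact ih.2
      _ = α ^ (n + 1) * dist z₁ z₂ := by ring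

variable [MetricSpace M] [CompactSpace M] [MetricSpace K] [CompactSpace K]

/-- A continuous observable composed with a high iterate of a fibre contracting skew product is
almost constant on the fibres. -/
theorem eventually_comp_iterate_close {f : M → M} {G : M × K → K} {α : ℝ} (hα : 0 ≤ α) (hα1 : α < 1)
    (hG : ∀ x z₁ z₂, dist (G (x, z₁)) (G (x, z₂)) ≤ α * dist z₁ z₂)
    {ψ : M × K → ℝ} (hψ : Continuous ψ) {ε : ℝ} (hε : 0 < ε) :
    ∀ᶠ n in Filter.atTop, ∀ x z₁ z₂,
      |ψ ((skew f G)^[n] (x, z₁)) - ψ ((skew f G)^[n] (x, z₂))| ≤ ε := by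
  obtain ⟨δ, hδ, h⟩ := Metric.uniformContinuous_iff.1
    (CompactSpace.uniformContinuous_of_continuous hψ) ε hε
  have hlim : Filter.Tendsto (fun n : ℕ => α ^ n * Metric.diam (univ : Set K)) Filter.atTop
      (𝓝 0) := by
    simpa using (tendsto_pow_atTop_nhds_zero_of_lt_one hα hα1).mul_const _
  filter_upwards [hlim.eventually (gt_mem_nhds hδ)] with n hn x z₁ z₂
  obtain ⟨h1, h2⟩ := skew_iterate_contract (f := f) hα hG n x z₁ z₂
  refine (h (a := (skew f G)^[n] (x, z₁)) (b := (skew f G)^[n] (x, z₂)) ?_).le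
  rw [Prod.dist_eq, h1, dist_self, max_lt_iff]
  refine ⟨hδ, h2.trans_lt (lt_of_le_of_lt ?_ hn)⟩
  gcongr
  exact Metric.dist_le_diam_of_mem isCompact_univ.isBounded (mem_univ _) (mem_univ _)

variable [MeasurableSpace M] [BorelSpace M] [MeasurableSpace K] [BorelSpace K]

theorem integrable_of_continuous_comp {μ : Measure (M × K)} [IsFiniteMeasure μ] {ψ : M × K → ℝ}
    (hψ : Continuous ψ) {T : M × K → M × K} (hT : Measurable T) : Integrable (ψ ∘ T) μ := by
  obtain ⟨C, hC⟩ := isCompact_univ.exists_bound_of_continuousOn hψ.continuousOn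
  exact Integrable.of_bound (hψ.measurable.comp hT).aestronglyMeasurable C
    (ae_of_all _ fun p => hC _ (mem_univ _))

variable [Nonempty K]

/-- Iterating a fibre contracting skew product brings together any two probabilities with
the same marginal. -/
theorem tendsto_integral_iterate_sub {f : M → M} (hf : Measurable f) {G : M × K → K}
    (hGm : Measurable G) {α : ℝ} (hα : 0 ≤ α) (hα1 : α < 1)
    (hG : ∀ x z₁ z₂, dist (G (x, z₁)) (G (x, z₂)) ≤ α * dist z₁ z₂)
    (μ ν : Measure (M × K)) [IsProbabilityMeasure μ] [IsProbabilityMeasure ν]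
    (hμν : μ.fst = ν.fst) {ψ : M × K → ℝ} (hψ : Continuous ψ) :
    Filter.Tendsto (fun n : ℕ => ∫ p, ψ ((skew f G)^[n] p) ∂μ - ∫ p, ψ ((skew f G)^[n] p) ∂ν)
      Filter.atTop (𝓝 0) := by
  rw [Metric.tendsto_nhds]
  intro ε hε
  obtain ⟨z₀⟩ := ‹Nonempty K›
  filter_upwards [eventually_comp_iterate_close (f := f) hα hα1 hG hψ (ε := ε / 3) (by positivity)]
    with n hn
  have hFn : Measurable ((skew f G)^[n]) := (measurable_skew hf hGm).iterate n
  have hz : Measurable (fun p : M × K => (skew f G)^[n] (p.1, z₀)) :=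
    hFn.comp (measurable_fst.prodMk measurable_const)
  -- Moving every point to height `z₀` costs at most `ε / 3` and leaves an integral that depends
  -- only on the marginal. Doing this for both measures costs `2ε / 3 < ε`.
  have key : ∀ (κ : Measure (M × K)) [IsProbabilityMeasure κ],
      |∫ p, ψ ((skew f G)^[n] p) ∂κ - ∫ x, ψ ((skew f G)^[n] (x, z₀)) ∂κ.fst| ≤ ε / 3 := by
    intro κ _
    have e : ∫ x, ψ ((skew f G)^[n] (x, z₀)) ∂κ.fst = ∫ p, ψ ((skew f G)^[n] (p.1, z₀)) ∂κ := by
      rw [Measure.fst, integral_map measurable_fst.aemeasurable]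
      exact (hψ.measurable.comp (hFn.comp
        (measurable_id.prodMk measurable_const))).aestronglyMeasurable
    have hi1 : Integrable (fun p => ψ ((skew f G)^[n] p)) κ := integrable_of_continuous_comp hψ hFn
    have hi2 : Integrable (fun p : M × K => ψ ((skew f G)^[n] (p.1, z₀))) κ :=
      integrable_of_continuous_comp hψ hz
    rw [e, ← integral_sub hi1 hi2]
    have := norm_integral_le_of_norm_le_const (μ := κ) (C := ε / 3)
      (f := fun p => ψ ((skew f G)^[n] p) - ψ ((skew f G)^[n] (p.1, z₀)))
      (ae_of_all _ fun p => by simpa using hn p.1 p.2 z₀)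
    simpa using this
  have h1 := abs_le.1 (key μ)
  have h2 := abs_le.1 (key ν)
  rw [hμν] at h1
  rw [dist_zero_right, Real.norm_eq_abs, abs_lt]
  constructor <;> linarith [h1.1, h1.2, h2.1, h2.2]

/-- A fibre contracting skew product has at most one invariant probability with a given marginal. -/
theorem eq_of_measurePreserving_skew {f : M → M} (hf : Measurable f) {G : M × K → K}
    (hGm : Measurable G) {α : ℝ} (hα : 0 ≤ α) (hα1 : α < 1)
    (hG : ∀ x z₁ z₂, dist (G (x, z₁)) (G (x, z₂)) ≤ α * dist z₁ z₂)
    (μ ν : Measure (M × K)) [IsProbabilityMeasure μ] [IsProbabilityMeasure ν]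
    (hμν : μ.fst = ν.fst) (hμ : MeasurePreserving (skew f G) μ μ)
    (hν : MeasurePreserving (skew f G) ν ν) : μ = ν := by
  refine ext_of_forall_integral_eq_of_IsFiniteMeasure fun ψ => ?_
  have h := tendsto_integral_iterate_sub hf hGm hα hα1 hG μ ν hμν ψ.continuous
  have hF := measurable_skew hf hGm
  have e : ∀ n : ℕ, ∫ p, ψ ((skew f G)^[n] p) ∂μ - ∫ p, ψ ((skew f G)^[n] p) ∂ν
      = ∫ p, ψ p ∂μ - ∫ p, ψ p ∂ν := fun n => by
    rw [integral_comp_iterate hF μ n ψ.continuous, integral_comp_iterate hF ν n ψ.continuous,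
      (hμ.iterate n).map_eq, (hν.iterate n).map_eq]
  simp only [e] at h
  exact sub_eq_zero.1 (tendsto_nhds_unique tendsto_const_nhds h)

/-- A bounded measurable function on `M × K`, continuous on the fibres, is approximated by
continuous functions, uniformly with respect to the measures with a given marginal. -/
theorem exists_continuous_integral_sub_le (m : Measure M) [IsProbabilityMeasure m]
    {θ : M × K → ℝ} (hθ : Measurable θ) (hθc : ∀ x, Continuous fun z => θ (x, z))
    {C : ℝ} (hC : ∀ p, |θ p| ≤ C) {ε : ℝ} (hε : 0 < ε) :
    ∃ ψ : M × K → ℝ, Continuous ψ ∧ ∀ (μ : Measure (M × K)) [IsProbabilityMeasure μ], μ.fst = m →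
      |∫ p, θ p ∂μ - ∫ p, ψ p ∂μ| ≤ ε := by
  -- Seen as a Bochner integrable map into `C(K, ℝ)`, `θ` is approximated in `L¹(m)` by a continuous
  -- map. The sup norm on the fibre makes the error depend on the marginal alone.
  let Θ : M → C(K, ℝ) := fun x => ⟨fun z => θ (x, z), hθc x⟩
  have hΘm : StronglyMeasurable Θ := measurable_curry_of_continuous Θ fun z =>
    hθ.comp (measurable_id.prodMk measurable_const)
  have hΘi : Integrable Θ m := Integrable.of_bound hΘm.aestronglyMeasurable C (ae_of_all _ fun x =>
    (ContinuousMap.norm_le_of_nonempty _).2 fun z => hC (x, z))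
  obtain ⟨g, hg, hgi⟩ := hΘi.exists_boundedContinuous_integral_sub_le hε
  have hψ : Continuous fun p : M × K => g p.1 p.2 :=
    ContinuousEval.continuous_eval.comp
      ((g.continuous.comp continuous_fst).prodMk continuous_snd)
  refine ⟨fun p => g p.1 p.2, hψ, fun μ _ hμ => ?_⟩
  have hi1 : Integrable θ μ := Integrable.of_bound hθ.aestronglyMeasurable C (ae_of_all _ hC)
  have hi2 : Integrable (fun p : M × K => g p.1 p.2) μ :=
    integrable_of_continuous_comp hψ measurable_id
  rw [← integral_sub hi1 hi2]
  have hi3 : Integrable (fun x => ‖Θ x - g x‖) m := (hΘi.sub hgi).norm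
  have hi4 : Integrable (fun p : M × K => ‖Θ p.1 - g p.1‖) μ := by
    rw [← hμ] at hi3
    exact hi3.comp_measurable measurable_fst
  calc |∫ p, (θ p - g p.1 p.2) ∂μ| ≤ ∫ p, |θ p - g p.1 p.2| ∂μ := abs_integral_le_integral_abs
    _ ≤ ∫ p, ‖Θ p.1 - g p.1‖ ∂μ := by
        refine integral_mono (hi1.sub hi2).abs hi4 fun p => ?_
        exact (Θ p.1 - g p.1).norm_coe_le_norm p.2
    _ = ∫ x, ‖Θ x - g x‖ ∂m := by
        rw [← hμ, Measure.fst, integral_map measurable_fst.aemeasurable]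
        rw [← hμ] at hi3
        exact hi3.aestronglyMeasurable
    _ ≤ ε := hg

/-- Existence of an invariant probability over an invariant probability of the base. -/
theorem exists_measurePreserving_skew {f : M → M} {m : Measure M} [IsProbabilityMeasure m]
    (hf : MeasurePreserving f m m) {G : M × K → K}
    (hGm : Measurable G) {α : ℝ} (hα : 0 ≤ α) (hα1 : α < 1)
    (hG : ∀ x z₁ z₂, dist (G (x, z₁)) (G (x, z₂)) ≤ α * dist z₁ z₂) :
    ∃ μ : ProbabilityMeasure (M × K), MeasurePreserving (skew f G) (μ : Measure (M × K)) μ ∧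
      (μ : Measure (M × K)).fst = m := by
  obtain ⟨z₀⟩ := ‹Nonempty K›
  have hF := measurable_skew hf.measurable hGm
  let μ₀ : Measure (M × K) := m.prod (Measure.dirac z₀)
  have hμ₀ : μ₀.fst = m := by simp [μ₀]
  let μn : ℕ → ProbabilityMeasure (M × K) := fun n =>
    ⟨μ₀.map (skew f G)^[n], Measure.isProbabilityMeasure_map (hF.iterate n).aemeasurable⟩
  have hsucc : ∀ n, (μn (n + 1) : Measure (M × K)) = (μn n : Measure (M × K)).map (skew f G) := by
    intro n
    change μ₀.map _ = (μ₀.map _).map _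
    rw [Measure.map_map hF (hF.iterate n), Function.iterate_succ']
  have hfst : ∀ n, (μn n : Measure (M × K)).fst = m := by
    intro n
    induction n with
    | zero => change (μ₀.map id).fst = m; rw [Measure.map_id, hμ₀]
    | succ n ih => rw [hsucc, fst_map_skew hf.measurable hGm, ih, hf.map_eq]
  -- A limit along a nonprincipal ultrafilter exists by weak compactness.
  obtain ⟨μ, -, hμ⟩ := (isCompact_univ (X := ProbabilityMeasure (M × K))).ultrafilter_le_nhds
    ((Filter.hyperfilter ℕ : Ultrafilter ℕ).map μn) (by simp)
  have hμt : Filter.Tendsto μn (Filter.hyperfilter ℕ : Filter ℕ) (𝓝 μ) := hμ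
  have hint := ProbabilityMeasure.tendsto_iff_forall_integral_tendsto.1 hμt
  have hintc : ∀ ψ : M × K → ℝ, Continuous ψ → Filter.Tendsto
      (fun n => ∫ p, ψ p ∂(μn n : Measure (M × K)))
      (Filter.hyperfilter ℕ : Filter ℕ) (𝓝 (∫ p, ψ p ∂(μ : Measure (M × K)))) := fun ψ hψ =>
    hint (BoundedContinuousFunction.mkOfCompact ⟨ψ, hψ⟩)
  have hμfst : (μ : Measure (M × K)).fst = m := by
    refine ext_of_forall_integral_eq_of_IsFiniteMeasure fun φ => ?_
    have e : ∀ κ : Measure (M × K), ∫ x, φ x ∂κ.fst = ∫ p, φ p.1 ∂κ := fun κ => by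
      rw [Measure.fst, integral_map measurable_fst.aemeasurable
        φ.continuous.measurable.aestronglyMeasurable]
    have h := hintc (fun p => φ p.1) (φ.continuous.comp continuous_fst)
    simp only [← e, hfst] at h
    exact tendsto_nhds_unique h tendsto_const_nhds
  refine ⟨μ, ⟨hF, ?_⟩, hμfst⟩
  have : IsProbabilityMeasure ((μ : Measure (M × K)).map (skew f G)) :=
    Measure.isProbabilityMeasure_map hF.aemeasurable
  refine ext_of_forall_integral_eq_of_IsFiniteMeasure fun ψ => ?_
  rw [integral_map hF.aemeasurable ψ.continuous.measurable.aestronglyMeasurable]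
  -- No Cesàro averages are needed: `μ₀` and its image share the marginal `m`, so their iterates
  -- merge.
  have hdiff : Filter.Tendsto (fun n => ∫ p, ψ p ∂(μn (n + 1) : Measure (M × K))
      - ∫ p, ψ p ∂(μn n : Measure (M × K))) (Filter.hyperfilter ℕ : Filter ℕ) (𝓝 0) := by
    have : IsProbabilityMeasure (μ₀.map (skew f G)) :=
      Measure.isProbabilityMeasure_map hF.aemeasurable
    have h := tendsto_integral_iterate_sub hf.measurable hGm hα hα1 hG (μ₀.map (skew f G)) μ₀
      (by rw [fst_map_skew hf.measurable hGm, hμ₀, hf.map_eq]) ψ.continuous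
    refine (h.mono_left Nat.hyperfilter_le_atTop).congr fun n => ?_
    rw [integral_comp_iterate hF _ n ψ.continuous, integral_comp_iterate hF _ n ψ.continuous,
      Measure.map_map (hF.iterate n) hF, ← Function.iterate_succ]
    rfl
  refine eq_of_abs_sub_le_all fun ε hε => ?_
  have hGc : ∀ x, Continuous fun z => G (x, z) := fun x =>
    (LipschitzWith.of_dist_le_mul (K := ⟨α, hα⟩) (hG x)).continuous
  -- `ψ ∘ F` is only measurable, though continuous on fibres, so weak convergence is applied to
  -- `ψ'`. The five errors are: `ψ ∘ F` against `ψ'` for `μ` and for `μn n`, convergence on `ψ'` and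
  -- on `ψ`, and the step from `n + 1` to `n`.
  obtain ⟨ψ', hψ', happ⟩ := exists_continuous_integral_sub_le m (θ := fun p => ψ (skew f G p))
    (ψ.continuous.measurable.comp hF)
    (fun x => ψ.continuous.comp ((continuous_const (y := f x)).prodMk (hGc x)))
    (C := ‖ψ‖) (fun p => ψ.norm_coe_le_norm _) (ε := ε / 5) (by positivity)
  have ev1 := (Metric.tendsto_nhds.1 hdiff) (ε / 5) (by positivity)
  have ev2 := (Metric.tendsto_nhds.1 (hintc ψ' hψ')) (ε / 5) (by positivity)
  have ev3 := (Metric.tendsto_nhds.1 (hintc ψ ψ.continuous)) (ε / 5) (by positivity)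
  obtain ⟨n, h1, h2, h3⟩ := (ev1.and (ev2.and ev3)).exists
  have h4 := happ μ hμfst
  have h5 := happ (μn n) (hfst n)
  have e : ∫ p, ψ (skew f G p) ∂(μn n : Measure (M × K)) =
      ∫ p, ψ p ∂(μn (n + 1) : Measure (M × K)) := by
    rw [hsucc, integral_map hF.aemeasurable ψ.continuous.measurable.aestronglyMeasurable]
  rw [e] at h5
  rw [Real.dist_eq, abs_lt] at h1 h2 h3
  rw [abs_le] at h4 h5 ⊢
  constructor <;> linarith [h1.1, h1.2, h2.1, h2.2, h3.1, h3.2, h4.1, h4.2, h5.1, h5.2]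

end FibreContraction

/-! ### From local to global Lipschitz bounds on a length space. -/

section LengthSpace

/-- On a Riemannian manifold, a function locally Lipschitz with a uniform constant is Lipschitz. -/
theorem lipschitzWith_of_locally (E : Type*) [NormedAddCommGroup E] [NormedSpace ℝ E]
    {M : Type*} [MetricSpace M] [ChartedSpace E M] [IsManifold 𝓘(ℝ, E) 1 M]
    [Bundle.RiemannianBundle (fun x : M => TangentSpace 𝓘(ℝ, E) x)]
    [IsRiemannianManifold 𝓘(ℝ, E) M] {h : M → ℝ} {C : ℝ≥0}
    (hloc : ∀ y, ∃ V ∈ 𝓝 y, ∀ a ∈ V, ∀ b ∈ V, edist (h a) (h b) ≤ C * edist a b) :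
    LipschitzWith C h := by
  intro a b
  have hlt : ∀ r : ℝ≥0∞, edist a b < r → edist (h a) (h b) ≤ C * r := by
    intro r hr
    rw [IsRiemannianManifold.out (I := 𝓘(ℝ, E)) a b] at hr
    obtain ⟨γ, h0, h1, hγ, hlen⟩ := Manifold.exists_lt_of_riemannianEDist_lt hr
    choose V hV hLip using hloc
    have hγc : Continuous fun t : unitInterval => γ t :=
      continuousOn_iff_continuous_domRestrict.1 hγ.continuousOn
    -- A subdivision of a nearly minimal curve puts each piece in one set where the local bound
    -- holds; the lengths of the pieces add up.
    obtain ⟨t, ht0, htm, ⟨N, hN⟩, ht⟩ := exists_monotone_Icc_subset_open_cover_unitInterval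
      (c := fun y : M => (fun t : unitInterval => γ t) ⁻¹' interior (V y))
      (fun y => isOpen_interior.preimage hγc)
      (fun s _ => mem_iUnion.2 ⟨γ s, mem_interior_iff_mem_nhds.2 (hV _)⟩)
    have key : ∀ n, edist (h a) (h (γ (t n))) ≤ C * Manifold.pathELength 𝓘(ℝ, E) γ 0 (t n) := by
      intro n
      induction n with
      | zero => simp [ht0, h0]
      | succ n ih =>
        obtain ⟨y, hy⟩ := ht n
        have hmono : t n ≤ t (n + 1) := htm n.le_succ
        have hstep : edist (h (γ (t n))) (h (γ (t (n + 1)))) ≤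
            C * Manifold.pathELength 𝓘(ℝ, E) γ (t n) (t (n + 1)) := by
          refine (hLip y _ (interior_subset (hy ⟨le_rfl, hmono⟩)) _
            (interior_subset (hy ⟨hmono, le_rfl⟩))).trans ?_
          gcongr
          rw [IsRiemannianManifold.out (I := 𝓘(ℝ, E))]
          exact Manifold.riemannianEDist_le_pathELength
            (hγ.mono (Icc_subset_Icc (t n).2.1 (t (n + 1)).2.2)) rfl rfl hmono
        calc edist (h a) (h (γ (t (n + 1))))
            ≤ edist (h a) (h (γ (t n))) + edist (h (γ (t n))) (h (γ (t (n + 1)))) :=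
              edist_triangle _ _ _
          _ ≤ C * Manifold.pathELength 𝓘(ℝ, E) γ 0 (t n) +
              C * Manifold.pathELength 𝓘(ℝ, E) γ (t n) (t (n + 1)) := add_le_add ih hstep
          _ = C * Manifold.pathELength 𝓘(ℝ, E) γ 0 (t (n + 1)) := by
              rw [← mul_add, Manifold.pathELength_add (t n).2.1 hmono]
    have := key N
    rw [hN N le_rfl] at this
    simp only [unitInterval, Icc.coe_one, h1] at this
    exact this.trans (by gcongr)
  -- The slack `ε / C` requires `C ≠ 0`; for `C = 0` any finite `r` serves.
  rcases eq_or_ne (C : ℝ≥0∞) 0 with hC | hC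
  · have := hlt (edist a b + 1) (ENNReal.lt_add_right (edist_ne_top a b) one_ne_zero)
    simpa [hC] using this
  · refine ENNReal.le_of_forall_pos_le_add fun ε hε _ => ?_
    have hε' : (ε : ℝ≥0∞) / C ≠ 0 := by simp [hε.ne']
    refine (hlt (edist a b + ε / C) (ENNReal.lt_add_right (edist_ne_top a b) hε')).trans ?_
    rw [mul_add, ENNReal.mul_div_cancel hC ENNReal.coe_ne_top]

end LengthSpace

/-! ### Inverse branches and sums over fibres. -/

section Branches

variable {X : Type*}

/-- The sum of a function over the fibres of `f`. -/
def fibreSum (f : X → X) (g : X → ℝ) (y : X) : ℝ := ∑ᶠ x ∈ f ⁻¹' {y}, g x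

theorem fibreSum_of_bijOn {f : X → X} {y₀ y : X} {s : X → X} (h : BijOn s (f ⁻¹' {y₀}) (f ⁻¹' {y}))
    (g : X → ℝ) : fibreSum f g y = fibreSum f (g ∘ s) y₀ :=
  (finsum_mem_eq_of_bijOn s h fun _ _ => rfl).symm

/-- At most `q` points of each fibre lie in a set covered by `q` domains of injectivity. -/
theorem CondF2.ncard_fibre_inter_le [TopologicalSpace X] [Nonempty X] {f : X → X}
    {A : Set X} {q : ℕ} (h : CondF2 f A q) (y : X) :
    (f ⁻¹' {y} ∩ A).ncard ≤ q := by
  obtain ⟨-, 𝒰, hU, -, 𝒱, hsub, rfl, hA⟩ := h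
  have hch : ∀ x ∈ f ⁻¹' {y} ∩ A, ∃ U ∈ 𝒱, x ∈ U := fun x hx => by
    simpa using hA hx.2
  classical
  choose! u hu hxu using hch
  rw [← Set.ncard_coe_finset]
  refine Set.ncard_le_ncard_of_injOn u (fun x hx => hu x hx) ?_ 𝒱.finite_toSet
  intro a ha b hb hab
  refine (hU _ (hsub (hu a ha))).2 (hxu a ha) ?_ (ha.1.trans hb.1.symm)
  rw [hab]
  exact hxu b hb

variable [TopologicalSpace X] [CompactSpace X] [T2Space X] {f : X → X}

theorem finite_fibre (hf : IsLocalHomeomorph f) (y : X) : (f ⁻¹' {y}).Finite := by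
  have hc : IsCompact (f ⁻¹' {y}) := (isClosed_singleton.preimage hf.continuous).isCompact
  refine hc.finite ?_
  refine IsDiscrete.of_nhdsWithin fun x hx => ?_
  obtain ⟨e, hxe, rfl⟩ := hf x
  rw [Filter.le_pure_iff, mem_nhdsWithin]
  refine ⟨e.source, e.open_source, hxe, fun x' hx' => ?_⟩
  exact e.injOn hx'.1 hxe (hx'.2.trans hx.symm)

/-- Local inverse branches of a local homeomorphism of a compact space, landing in prescribed
neighbourhoods of the points of the fibre. -/
theorem exists_branches (hf : IsLocalHomeomorph f) (y₀ : X) (U : X → Set X)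
    (hU : ∀ x, U x ∈ 𝓝 x) :
    ∃ V ∈ 𝓝 y₀, ∃ s : X → X → X,
      (∀ i ∈ f ⁻¹' {y₀}, ContinuousOn (s i) V ∧ ∀ y ∈ V, s i y ∈ U i) ∧
      ∀ y ∈ V, BijOn (fun i => s i y) (f ⁻¹' {y₀}) (f ⁻¹' {y}) := by
  have hfin := finite_fibre hf y₀
  obtain ⟨W, hW, hdisj⟩ := hfin.t2_separation
  choose e hmem he using hf
  let O : X → Set X := fun i => (e i).source ∩ W i ∩ interior (U i)
  have hO : ∀ i, IsOpen (O i) := fun i => ((e i).open_source.inter (hW i).2).inter isOpen_interior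
  have hiO : ∀ i, i ∈ O i := fun i =>
    ⟨⟨hmem i, (hW i).1⟩, mem_interior_iff_mem_nhds.2 (hU i)⟩
  have hfc : Continuous f := IsLocalHomeomorph.continuous fun x => ⟨e x, hmem x, he x⟩
  have hfo : IsOpenMap f := IsLocalHomeomorph.isOpenMap fun x => ⟨e x, hmem x, he x⟩
  -- The first factor makes each `O i` meet the fibre of `y`; the second, open because the image of
  -- a compact set is closed, forbids preimages outside the `O i`.
  let V : Set X := (⋂ i ∈ f ⁻¹' {y₀}, f '' O i) ∩ (f '' (⋃ i ∈ f ⁻¹' {y₀}, O i)ᶜ)ᶜ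
  have hVo : IsOpen V := by
    refine (hfin.isOpen_biInter fun i _ => hfo _ (hO i)).inter ?_
    exact ((isOpen_biUnion fun i _ =>
      hO i).isClosed_compl.isCompact.image hfc).isClosed.isOpen_compl
  have hyV : y₀ ∈ V := by
    refine ⟨mem_iInter₂.2 fun i hi => ⟨i, hiO i, hi⟩, ?_⟩
    rintro ⟨x, hx, hxy⟩
    exact hx (mem_iUnion₂.2 ⟨x, hxy, hiO x⟩)
  have hs : ∀ i, ∀ x ∈ O i, (e i).symm (f x) = x := by
    intro i x hx
    rw [he i]
    exact (e i).left_inv hx.1.1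
  have hsO : ∀ i ∈ f ⁻¹' {y₀}, ∀ y ∈ V, (e i).symm y ∈ O i ∧ f ((e i).symm y) = y := by
    intro i hi y hy
    obtain ⟨x, hx, rfl⟩ := mem_iInter₂.1 hy.1 i hi
    rw [hs i x hx]
    exact ⟨hx, rfl⟩
  refine ⟨V, hVo.mem_nhds hyV, fun i => (e i).symm, fun i hi => ⟨?_, fun y hy =>
    interior_subset (hsO i hi y hy).1.2⟩, fun y hy => ⟨fun i hi => (hsO i hi y hy).2, ?_, ?_⟩⟩
  · refine (e i).continuousOn_symm.mono fun y hy => ?_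
    obtain ⟨x, hx, rfl⟩ := mem_iInter₂.1 hy.1 i hi
    rw [he i]
    exact (e i).map_source hx.1.1
  · intro i hi j hj hij
    by_contra hne
    have h1 := (hsO i hi y hy).1.1.2
    have h2 := (hsO j hj y hy).1.1.2
    simp only at hij
    rw [hij] at h1
    exact (disjoint_left.1 (hdisj hi hj hne)) h1 h2
  · intro x hx
    have : x ∈ ⋃ i ∈ f ⁻¹' {y₀}, O i := by
      by_contra hcon
      exact hy.2 ⟨x, hcon, hx⟩
    obtain ⟨i, hi, hxi⟩ := mem_iUnion₂.1 this
    refine ⟨i, hi, ?_⟩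
    have hx' : f x = y := hx
    simp only [← hx', hs i x hxi]

theorem fibreSum_eq_sum (hf : IsLocalHomeomorph f) (g : X → ℝ) (y : X) :
    fibreSum f g y = ∑ x ∈ (finite_fibre hf y).toFinset, g x :=
  finsum_mem_eq_finite_toFinset_sum _ _

theorem fibreSum_mono (hf : IsLocalHomeomorph f) {g h : X → ℝ} {y : X}
    (hgh : ∀ x, f x = y → g x ≤ h x) : fibreSum f g y ≤ fibreSum f h y := by
  rw [fibreSum_eq_sum hf, fibreSum_eq_sum hf]
  exact Finset.sum_le_sum fun x hx => hgh x (by simpa using hx)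

theorem fibreSum_const_mul (hf : IsLocalHomeomorph f) (c : ℝ) (g : X → ℝ) (y : X) :
    fibreSum f (fun x => c * g x) y = c * fibreSum f g y := by
  rw [fibreSum_eq_sum hf, fibreSum_eq_sum hf, Finset.mul_sum]

theorem fibreSum_add (hf : IsLocalHomeomorph f) (g h : X → ℝ) (y : X) :
    fibreSum f (fun x => g x + h x) y = fibreSum f g y + fibreSum f h y := by
  rw [fibreSum_eq_sum hf, fibreSum_eq_sum hf, fibreSum_eq_sum hf, Finset.sum_add_distrib]

theorem continuous_fibreSum (hf : IsLocalHomeomorph f) {g : X → ℝ} (hg : Continuous g) :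
    Continuous (fibreSum f g) := by
  refine continuous_iff_continuousAt.2 fun y₀ => ?_
  obtain ⟨V, hV, s, hs, hbij⟩ := exists_branches hf y₀ (fun _ => univ) fun _ => Filter.univ_mem
  have e : fibreSum f g =ᶠ[𝓝 y₀] fun y => ∑ i ∈ (finite_fibre hf y₀).toFinset, g (s i y) := by
    filter_upwards [hV] with y hy
    rw [fibreSum_of_bijOn (hbij y hy), fibreSum_eq_sum hf]
    rfl
  refine ContinuousAt.congr ?_ e.symm
  refine tendsto_finsetSum _ fun i hi => ?_
  exact hg.continuousAt.comp ((hs i (by simpa using hi)).1.continuousAt hV)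

theorem ncard_fibre_eq_mapDegree [ConnectedSpace X] (hf : IsLocalHomeomorph f) (y : X) :
    (f ⁻¹' {y}).ncard = mapDegree f := by
  have hloc : IsLocallyConstant fun y => (f ⁻¹' {y}).ncard := by
    rw [IsLocallyConstant.iff_eventually_eq]
    intro y₀
    obtain ⟨V, hV, s, -, hbij⟩ := exists_branches hf y₀ (fun _ => univ) fun _ => Filter.univ_mem
    filter_upwards [hV] with y hy
    rw [← (hbij y hy).image_eq, (hbij y hy).injOn.ncard_image]
  exact hloc.apply_eq_of_isPreconnected isPreconnected_univ (mem_univ _) (mem_univ _)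

end Branches

/-! ### Contraction of averages and constancy of fixed functions. -/

section Contraction

variable {M : Type*} [MetricSpace M] [CompactSpace M] {f : M → M} {L : M → ℝ}

/-- Near `y₀` the fibres of `a` and `b` are paired by the inverse branches, and the branch through
`i` moves points by at most `L i * dist a b`. -/
theorem edist_fibreSum_le (hf : IsLocalHomeomorph f) (hL : LocalInverseLipschitz f L)
    {c : ℝ≥0} (hc : ∀ y, fibreSum f (fun x => max (L x) 0) y ≤ c) {u : M → ℝ}
    (hu : LipschitzWith 1 u) (y₀ : M) :
    ∃ V ∈ 𝓝 y₀, ∀ a ∈ V, ∀ b ∈ V, edist (fibreSum f u a) (fibreSum f u b) ≤ c * edist a b := by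
  choose U hU hinj hlip using hL
  obtain ⟨V, hV, s, hs, hbij⟩ := exists_branches hf y₀ U hU
  refine ⟨V, hV, fun a ha b hb => ?_⟩
  suffices h : dist (fibreSum f u a) (fibreSum f u b) ≤ c * dist a b by
    rw [edist_dist, edist_dist, ← ENNReal.ofReal_coe_nnreal,
      ← ENNReal.ofReal_mul c.coe_nonneg]
    exact ENNReal.ofReal_le_ofReal h
  rw [fibreSum_of_bijOn (hbij a ha), fibreSum_of_bijOn (hbij b hb), fibreSum_eq_sum hf,
    fibreSum_eq_sum hf]
  refine (dist_sum_sum_le _ _ _).trans ?_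
  calc _ ≤ ∑ i ∈ (finite_fibre hf y₀).toFinset, max (L i) 0 * dist a b := by
        refine Finset.sum_le_sum fun i hi => ?_
        have hi' : i ∈ f ⁻¹' {y₀} := by simpa using hi
        have h1 : dist (u (s i a)) (u (s i b)) ≤ dist (s i a) (s i b) := by
          simpa using hu.dist_le_mul (s i a) (s i b)
        have h2 := hlip i _ ((hs i hi').2 a ha) _ ((hs i hi').2 b hb)
        have ea : f (s i a) = a := (hbij a ha).mapsTo hi'
        have eb : f (s i b) = b := (hbij b hb).mapsTo hi'
        rw [ea, eb] at h2
        refine h1.trans (h2.trans ?_)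
        gcongr
        exact le_max_left _ _
    _ = fibreSum f (fun x => max (L x) 0) y₀ * dist a b := by
        rw [fibreSum_eq_sum hf, Finset.sum_mul]
    _ ≤ c * dist a b := by gcongr; exact hc y₀

/-- The sum of the Lipschitz constants of the inverse branches. -/
theorem fibreSum_max_le [ConnectedSpace M] {A : Set M} {σ Λ : ℝ} {q : ℕ}
    (hf : IsLocalHomeomorph f) (hσ : 1 < σ) (hΛ : 1 ≤ Λ)
    (hf1 : CondF1 L A σ Λ) (hf2 : CondF2 f A q) (y : M) :
    fibreSum f (fun x => max (L x) 0) y ≤ ((mapDegree f : ℝ) - q) * σ⁻¹ + q * Λ := by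
  classical
  have hσ0 : σ⁻¹ ≤ 1 := inv_le_one_of_one_le₀ hσ.le
  have hσp : 0 < σ⁻¹ := by positivity
  rw [fibreSum_eq_sum hf]
  set s := (finite_fibre hf y).toFinset with hs
  have hcard : (s.card : ℝ) = mapDegree f := by
    rw [← ncard_fibre_eq_mapDegree hf y, Set.ncard_eq_toFinset_card _ (finite_fibre hf y)]
  have hq : ((s.filter (· ∈ A)).card : ℝ) ≤ q := by
    have h := hf2.ncard_fibre_inter_le y
    have e : f ⁻¹' {y} ∩ A = ↑(s.filter (· ∈ A)) := by ext x; simp [hs]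
    rw [e, Set.ncard_coe_finset] at h
    exact_mod_cast h
  calc ∑ x ∈ s, max (L x) 0 ≤ ∑ x ∈ s, (σ⁻¹ + if x ∈ A then Λ - σ⁻¹ else 0) := by
        refine Finset.sum_le_sum fun x _ => ?_
        split_ifs with hx
        · rw [add_sub_cancel]; exact max_le (hf1.1 x hx) (by linarith)
        · rw [add_zero]; exact max_le (hf1.2 x hx).le hσp.le
    _ = mapDegree f * σ⁻¹ + (s.filter (· ∈ A)).card * (Λ - σ⁻¹) := by
        rw [Finset.sum_add_distrib, ← Finset.sum_filter]
        simp only [Finset.sum_const, nsmul_eq_mul, hcard]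
    _ ≤ mapDegree f * σ⁻¹ + q * (Λ - σ⁻¹) := by
        gcongr
        linarith
    _ = _ := by ring

/-- A continuous function on a closed backward invariant set `S` which is fixed by the weighted
averages over the fibres is constant on `S`, if averages of the distances contract. -/
theorem eqOn_const_of_fixed (hf : IsLocalHomeomorph f) {ρ : M → ℝ} (hρ : ∀ x, 0 < ρ x)
    {S : Set M} (hS : IsClosed S) (hSne : S.Nonempty) (hSf : f ⁻¹' S ⊆ S)
    (hρ1 : ∀ y ∈ S, fibreSum f ρ y = 1) {c : ℝ≥0}
    (hLip : ∀ u : M → ℝ, LipschitzWith 1 u → LipschitzWith c (fibreSum f u))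
    {r : ℝ} (hr : ∀ x, ρ x ≤ r) (hrc : r * c < 1)
    {φ : M → ℝ} (hφ : Continuous φ) (hfix : ∀ y ∈ S, fibreSum f (fun x => ρ x * φ x) y = φ y) :
    ∃ a, ∀ y ∈ S, φ y = a := by
  obtain ⟨p, hpS, hp⟩ := hS.isCompact.exists_isMaxOn hSne hφ.continuousOn
  have hmax : ∀ y ∈ S, φ y ≤ φ p := fun y hy => hp hy
  set a := φ p
  have hr0 : 0 ≤ r := (hρ p).le.trans (hr p)
  -- the deficit `a - φ` is fixed by the averages as well
  have hw : ∀ y ∈ S, fibreSum f (fun x => ρ x * (a - φ x)) y = a - φ y := by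
    intro y hy
    have e : (fun x => ρ x * (a - φ x)) = fun x => a * ρ x + (-1) * (ρ x * φ x) := by
      ext x; ring
    rw [e, fibreSum_add hf, fibreSum_const_mul hf, fibreSum_const_mul hf, hfix y hy, hρ1 y hy]
    ring
  let Z : Set M := S ∩ {y | φ y = a}
  have hZne : Z.Nonempty := ⟨p, hpS, rfl⟩
  have hZc : IsClosed Z := hS.inter (isClosed_eq hφ continuous_const)
  -- Over a point of `Z` the average of the nonnegative deficit is zero, and positive weights force
  -- every term to vanish.
  have hZf : ∀ x, f x ∈ Z → x ∈ Z := by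
    rintro x ⟨hxS, hxa⟩
    have h0 := hw (f x) hxS
    rw [hxa, sub_self, fibreSum_eq_sum hf, Finset.sum_eq_zero_iff_of_nonneg] at h0
    · have := h0 x (by simp)
      refine ⟨hSf hxS, ?_⟩
      have := (mul_eq_zero.1 this).resolve_left (hρ x).ne'
      exact (sub_eq_zero.1 this).symm
    · intro x' hx'
      have hx'' : f x' = f x := by simpa using hx'
      have : x' ∈ S := hSf (show f x' ∈ S by rw [hx'']; exact hxS)
      exact mul_nonneg (hρ x').le (sub_nonneg.2 (hmax x' this))
  let u : M → ℝ := fun x => Metric.infDist x Z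
  have hu0 : ∀ x, 0 ≤ u x := fun x => Metric.infDist_nonneg
  have hTu : ∀ y, fibreSum f u y ≤ c * u y := by
    intro y
    -- Compare `y` with its nearest point `z` of `Z`, where the fibre sum of `u` is zero.
    obtain ⟨z, hz, hzd⟩ := hZc.isCompact.exists_infDist_eq_dist hZne y
    have h0 : fibreSum f u z = 0 := by
      rw [fibreSum_eq_sum hf]
      refine Finset.sum_eq_zero fun x hx => ?_
      have hx' : f x = z := by simpa using hx
      exact Metric.infDist_zero_of_mem (hZf x (by rw [hx']; exact hz))
    have h := (hLip u (Metric.lipschitz_infDist_pt Z)).dist_le_mul y z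
    rw [h0, dist_zero_right, ← hzd] at h
    exact (le_abs_self _).trans h
  have hLu : ∀ y, fibreSum f (fun x => ρ x * u x) y ≤ (r * c) * u y := by
    intro y
    calc fibreSum f (fun x => ρ x * u x) y ≤ fibreSum f (fun x => r * u x) y :=
          fibreSum_mono hf fun x _ => mul_le_mul_of_nonneg_right (hr x) (hu0 x)
      _ = r * fibreSum f u y := fibreSum_const_mul hf _ _ _
      _ ≤ r * (c * u y) := by gcongr; exact hTu y
      _ = _ := by ring
  refine ⟨a, fun y hy => le_antisymm (hmax y hy) ?_⟩
  refine le_of_forall_pos_le_add fun η hη => ?_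
  obtain ⟨δ, hδ, hδ'⟩ := Metric.uniformContinuous_iff.1
    (CompactSpace.uniformContinuous_of_continuous hφ) η hη
  obtain ⟨B, hB⟩ := isCompact_univ.exists_bound_of_continuousOn
    (f := fun x => a - φ x) (by fun_prop)
  have hB0 : 0 ≤ B := (norm_nonneg _).trans (hB p (mem_univ _))
  -- For `n = 0`, uniform continuity gives the bound `η` within `δ` of `Z`, and `B ≤ (B / δ) u`
  -- elsewhere. Each average then keeps `η` and multiplies the term in `u` by `r * c`.
  have hind : ∀ n : ℕ, ∀ y ∈ S, a - φ y ≤ η + B / δ * (r * c) ^ n * u y := by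
    intro n
    induction n with
    | zero =>
      intro y _
      rw [pow_zero, mul_one]
      rcases lt_or_ge (u y) δ with h | h
      · obtain ⟨z, hz, hzd⟩ := hZc.isCompact.exists_infDist_eq_dist hZne y
        have hd : dist y z < δ := by rw [← hzd]; exact h
        have h1 := hδ' hd
        rw [Real.dist_eq, abs_lt, show φ z = a from hz.2] at h1
        have : 0 ≤ B / δ * u y := mul_nonneg (by positivity) (hu0 y)
        linarith [h1.1]
      · have h1 : a - φ y ≤ B := (le_abs_self _).trans (hB y (mem_univ _))
        have h2 : B ≤ B / δ * u y := by
          rw [div_mul_eq_mul_div, le_div_iff₀ hδ]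
          gcongr
        linarith
    | succ n ih =>
      intro y hy
      rw [← hw y hy]
      have hk : 0 ≤ B / δ * (r * c) ^ n := by positivity
      calc fibreSum f (fun x => ρ x * (a - φ x)) y
          ≤ fibreSum f (fun x => η * ρ x + (B / δ * (r * c) ^ n) * (ρ x * u x)) y := by
            refine fibreSum_mono hf fun x hx => ?_
            have hxS : x ∈ S := hSf (show f x ∈ S by rw [hx]; exact hy)
            calc ρ x * (a - φ x) ≤ ρ x * (η + B / δ * (r * c) ^ n * u x) :=
                  mul_le_mul_of_nonneg_left (ih x hxS) (hρ x).le
              _ = _ := by ring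
        _ = η + (B / δ * (r * c) ^ n) * fibreSum f (fun x => ρ x * u x) y := by
            rw [fibreSum_add hf, fibreSum_const_mul hf, fibreSum_const_mul hf, hρ1 y hy, mul_one]
        _ ≤ η + (B / δ * (r * c) ^ n) * ((r * c) * u y) := by gcongr; exact hLu y
        _ = _ := by ring
  have hlim : Filter.Tendsto (fun n : ℕ => η + B / δ * (r * c) ^ n * u y) Filter.atTop (𝓝 η) := by
    have := ((tendsto_pow_atTop_nhds_zero_of_lt_one (r := r * c) (by positivity) hrc).const_mul
      (B / δ)).mul_const (u y)
    simpa using this.const_add η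
  have := ge_of_tendsto' hlim fun n => hind n y hy
  linarith

end Contraction

/-! ### Change of variables and the transfer operator. -/

section AreaFormula

variable {M : Type*} [MeasurableSpace M] [StandardBorelSpace M] {f : M → M} {m : Measure M}
  {J : M → ℝ}

/-- By injectivity the fibre sum has at most one nonzero term, so it is `g` carried to `f '' A` and
extended by zero; `f` pushes `J dm` on `A` to `m` on `f '' A`. -/
theorem IsJacobian.lintegral_of_injOn (hf : Measurable f) (hJ : IsJacobian f m J) {A : Set M}
    (hA : MeasurableSet A) (hinj : InjOn f A) {g : M → ℝ≥0∞} (hg : Measurable g) :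
    (Measurable fun y => ∑' x : f ⁻¹' {y}, A.indicator g x) ∧
      ∫⁻ x in A, g x * ENNReal.ofReal (J x) ∂m = ∫⁻ y, ∑' x : f ⁻¹' {y}, A.indicator g x ∂m := by
  have := hA.standardBorel
  let e : A → M := fun x => f x
  have hei : Function.Injective e := hinj.injective
  have he : MeasurableEmbedding e := (hf.comp measurable_subtype_coe).measurableEmbedding hei
  have hext : (fun y => ∑' x : f ⁻¹' {y}, A.indicator g x) =
      Function.extend e (fun x : A => g x) 0 := by
    ext y
    by_cases hy : ∃ x, e x = y
    · obtain ⟨x, rfl⟩ := hy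
      rw [hei.extend_apply, tsum_eq_single ⟨(x : M), rfl⟩, indicator_of_mem x.2]
      rintro ⟨x', hx'⟩ hne
      refine indicator_of_notMem (fun hA' => hne ?_) _
      exact Subtype.ext (hinj hA' x.2 hx')
    · rw [Function.extend_apply' _ _ _ hy, Pi.zero_apply, ENNReal.tsum_eq_zero]
      rintro ⟨x', hx'⟩
      exact indicator_of_notMem (fun hA' => hy ⟨⟨x', hA'⟩, hx'⟩) _
  have hGm : Measurable (Function.extend e (fun x : A => g x) 0) :=
    he.measurable_extend (hg.comp measurable_subtype_coe) measurable_zero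
  rw [hext]
  refine ⟨hGm, ?_⟩
  have hJm : Measurable fun x => ENNReal.ofReal (J x) := hJ.measurable.ennreal_ofReal
  have hrange : f '' A = range e := by
    rw [image_eq_range]
  have hmap : ((m.restrict A).withDensity fun x => ENNReal.ofReal (J x)).map f =
      m.restrict (f '' A) := by
    ext B hB
    rw [Measure.map_apply hf hB, withDensity_apply _ (hf hB), Measure.restrict_restrict (hf hB),
      ← hJ.image _ ((hf hB).inter hA) (hinj.mono inter_subset_right), Measure.restrict_apply hB,
      inter_comm, image_inter_preimage, inter_comm]
  have hsupp : ∫⁻ y, Function.extend e (fun x : A => g x) 0 y ∂m =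
      ∫⁻ y in f '' A, Function.extend e (fun x : A => g x) 0 y ∂m := by
    refine (setLIntegral_eq_of_support_subset ?_).symm
    intro y hy
    by_contra hcon
    rw [hrange] at hcon
    exact hy (Function.extend_apply' _ _ _ hcon)
  rw [hsupp, ← hmap, lintegral_map hGm hf,
    lintegral_withDensity_eq_lintegral_mul _ hJm
      (g := fun x => Function.extend e (fun x : A => g x) 0 (f x)) (hGm.comp hf)]
  refine setLIntegral_congr_fun hA fun x hx => ?_
  have : Function.extend e (fun x : A => g x) 0 (f x) = g x :=
    hei.extend_apply (fun x : A => g x) 0 ⟨x, hx⟩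
  simp only [Pi.mul_apply, this, mul_comm]

/-- Change of variables for a map with a Jacobian which is injective on the sets of a countable
covering. -/
theorem IsJacobian.lintegral_mul (hf : Measurable f) (hJ : IsJacobian f m J) {U : ℕ → Set M}
    (hU : ∀ n, MeasurableSet (U n)) (hinj : ∀ n, InjOn f (U n)) (hcov : ⋃ n, U n = univ)
    {g : M → ℝ≥0∞} (hg : Measurable g) :
    (Measurable fun y => ∑' x : f ⁻¹' {y}, g x) ∧
      ∫⁻ x, g x * ENNReal.ofReal (J x) ∂m = ∫⁻ y, ∑' x : f ⁻¹' {y}, g x ∂m := by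
  have hD : ∀ n, MeasurableSet (disjointed U n) := fun n => MeasurableSet.disjointed hU n
  have hDinj : ∀ n, InjOn f (disjointed U n) := fun n => (hinj n).mono (disjointed_subset U n)
  have key := fun n => hJ.lintegral_of_injOn hf (hD n) (hDinj n) hg
  have hsum : ∀ x, ∑' n, (disjointed U n).indicator g x = g x := by
    intro x
    obtain ⟨n, hn⟩ : ∃ n, x ∈ disjointed U n := by
      rw [← mem_iUnion, iUnion_disjointed, hcov]
      trivial
    rw [tsum_eq_single n, indicator_of_mem hn]
    intro k hk
    exact indicator_of_notMem
      (fun hk' => disjoint_left.1 (disjoint_disjointed U hk) hk' hn) _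
  have e : (fun y => ∑' x : f ⁻¹' {y}, g x) =
      fun y => ∑' n, ∑' x : f ⁻¹' {y}, (disjointed U n).indicator g x := by
    ext y
    rw [ENNReal.tsum_comm]
    simp only [hsum]
  rw [e]
  refine ⟨Measurable.tsum fun n => (key n).1, ?_⟩
  rw [lintegral_tsum fun n => (key n).1.aemeasurable, ← setLIntegral_univ, ← hcov,
    ← iUnion_disjointed, lintegral_iUnion hD (disjoint_disjointed U)]
  exact tsum_congr fun n => (key n).2

/-- The density of an invariant measure is fixed by the transfer operator. -/
theorem IsJacobian.ae_eq_tsum_fibre [SigmaFinite m] (hf : Measurable f) (hJ : IsJacobian f m J)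
    {U : ℕ → Set M} (hU : ∀ n, MeasurableSet (U n)) (hinj : ∀ n, InjOn f (U n))
    (hcov : ⋃ n, U n = univ) {ρ : M → ℝ≥0∞} (hρ : Measurable ρ)
    (hρJ : ∀ x, ρ x * ENNReal.ofReal (J x) = 1) {h : M → ℝ≥0∞} (hh : Measurable h)
    (hinv : (m.withDensity h).map f = m.withDensity h) :
    h =ᵐ[m] fun y => ∑' x : f ⁻¹' {y}, ρ x * h x := by
  refine ae_eq_of_forall_setLIntegral_eq_of_sigmaFinite hh
    (hJ.lintegral_mul hf hU hinj hcov (hρ.mul hh)).1 fun B hB _ => ?_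
  have hBf : MeasurableSet (f ⁻¹' B) := hf hB
  have h1 := (hJ.lintegral_mul hf hU hinj hcov ((hρ.mul hh).indicator hBf)).2
  calc ∫⁻ x in B, h x ∂m = (m.withDensity h) B := (withDensity_apply _ hB).symm
    _ = (m.withDensity h) (f ⁻¹' B) := by
        conv_lhs => rw [← hinv, Measure.map_apply hf hB]
    _ = ∫⁻ x in f ⁻¹' B, h x ∂m := withDensity_apply _ hBf
    _ = ∫⁻ x, (f ⁻¹' B).indicator (ρ * h) x * ENNReal.ofReal (J x) ∂m := by
        rw [← lintegral_indicator hBf]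
        refine lintegral_congr fun x => ?_
        by_cases hx : x ∈ f ⁻¹' B
        · rw [indicator_of_mem hx, indicator_of_mem hx, Pi.mul_apply, mul_right_comm, hρJ, one_mul]
        · rw [indicator_of_notMem hx, indicator_of_notMem hx, zero_mul]
    _ = ∫⁻ y, ∑' x : f ⁻¹' {y}, (f ⁻¹' B).indicator (ρ * h) x ∂m := h1
    _ = ∫⁻ y in B, ∑' x : f ⁻¹' {y}, ρ x * h x ∂m := by
        rw [← lintegral_indicator hB]
        refine lintegral_congr fun y => ?_
        by_cases hy : y ∈ B
        · rw [indicator_of_mem hy]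
          refine tsum_congr fun x => indicator_of_mem ?_ _
          have hx : f x = y := x.2
          simpa [hx] using hy
        · rw [indicator_of_notMem hy, ENNReal.tsum_eq_zero]
          intro x
          refine indicator_of_notMem ?_ _
          have hx : f x = y := x.2
          simpa [hx] using hy

end AreaFormula

/-! ### The linear form of the constants, and fixed points on the support. -/

section Marginal

/-- The linear form of the relation between the constants. -/
theorem CondConstants.linear {ζ : ℝ≥0} {d q : ℕ} {σ Λ ε : ℝ}
    (hζ1 : ζ ≤ 1) (hqd : q ≤ d) (hσ : 1 < σ) (hΛ1 : 1 ≤ Λ) (hΛ2 : Λ ≤ 2)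
    (h : CondConstants ζ d q σ Λ ε) :
    Real.exp ε / d * (((d : ℝ) - q) * σ⁻¹ + q * Λ) < 1 := by
  refine lt_of_le_of_lt ?_ h
  have hζ1' : (ζ : ℝ) ≤ 1 := by exact_mod_cast hζ1
  have hqd' : (0 : ℝ) ≤ (d : ℝ) - q := sub_nonneg.2 (by exact_mod_cast hqd)
  have h1 : σ⁻¹ ≤ σ ^ (-(ζ : ℝ)) := by
    rw [← Real.rpow_neg_one]
    exact Real.rpow_le_rpow_of_exponent_le hσ.le (by linarith)
  -- `Λ ≤ 2` puts `Λ - 1` in `[0, 1]`, where the power `ζ ≤ 1` increases it.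
  have h2 : Λ - 1 ≤ (Λ - 1) ^ (ζ : ℝ) :=
    Real.self_le_rpow_of_le_one (by linarith) (by linarith) hζ1'
  have h3 : 1 ≤ Λ ^ (ζ : ℝ) := Real.one_le_rpow hΛ1 ζ.coe_nonneg
  have h4 : Λ ≤ Λ ^ (ζ : ℝ) * (1 + (Λ - 1) ^ (ζ : ℝ)) := by nlinarith
  rw [div_mul_eq_mul_div, mul_div_assoc, mul_assoc (q : ℝ)]
  gcongr

variable {M : Type*} [MetricSpace M] {f : M → M}

theorem tsum_fibre_ofReal [CompactSpace M] (hf : IsLocalHomeomorph f) {g : M → ℝ}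
    (hg : ∀ x, 0 ≤ g x) (y : M) :
    ∑' x : f ⁻¹' {y}, ENNReal.ofReal (g x) = ENNReal.ofReal (fibreSum f g y) := by
  rw [fibreSum_eq_sum hf, ENNReal.ofReal_sum_of_nonneg fun x _ => hg x]
  have := (finite_fibre hf y).fintype
  rw [tsum_fintype]
  refine Finset.sum_bij (fun x _ => (x : M)) (by simp) (fun _ _ _ _ h => Subtype.ext h) ?_
    (fun _ _ => rfl)
  intro b hb
  exact ⟨⟨b, by simpa using hb⟩, Finset.mem_univ _, rfl⟩

variable [MeasurableSpace M] [BorelSpace M] {m : Measure M} {J : M → ℝ}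

/-- If `x` had a null neighbourhood, the Jacobian formula would make its image, a neighbourhood of
`f x`, null. -/
theorem IsJacobian.preimage_support_subset (hf : IsLocalHomeomorph f) (hJ : IsJacobian f m J) :
    f ⁻¹' m.support ⊆ m.support := by
  intro x hx
  rw [Measure.mem_support_iff_forall]
  intro U hU
  obtain ⟨e, hxe, rfl⟩ := hf x
  let W := interior U ∩ e.source
  have hW : IsOpen W := isOpen_interior.inter e.open_source
  have hxW : x ∈ W := ⟨mem_interior_iff_mem_nhds.2 hU, hxe⟩
  have hpos := (Measure.mem_support_iff_forall _).1 hx (e '' W)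
    ((hf.isOpenMap W hW).mem_nhds ⟨x, hxW, rfl⟩)
  rw [hJ.image W hW.measurableSet (e.injOn.mono inter_subset_right)] at hpos
  refine pos_iff_ne_zero.2 fun h0 => hpos.ne' ?_
  exact setLIntegral_measure_zero _ _
    (measure_mono_null (inter_subset_left.trans interior_subset) h0)

/-- On the support of `m`, a continuous invariant density is fixed by the transfer operator. -/
theorem IsJacobian.fibreSum_eq_on_support [CompactSpace M] [IsFiniteMeasure m]
    (hf : IsLocalHomeomorph f) (hJ : IsJacobian f m J)
    {U : ℕ → Set M} (hU : ∀ n, MeasurableSet (U n)) (hinj : ∀ n, InjOn f (U n))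
    (hcov : ⋃ n, U n = univ) {ρ : M → ℝ} (hρ : Continuous ρ) (hρ0 : ∀ x, 0 < ρ x)
    (hρJ : ∀ x, ρ x * J x = 1) {h : M → ℝ} (hh : Continuous h) (hh0 : ∀ x, 0 ≤ h x)
    (hinv : (m.withDensity fun x => ENNReal.ofReal (h x)).map f =
      m.withDensity fun x => ENNReal.ofReal (h x)) :
    ∀ y ∈ m.support, fibreSum f (fun x => ρ x * h x) y = h y := by
  have hae := hJ.ae_eq_tsum_fibre hf.continuous.measurable hU hinj hcov
    (ρ := fun x => ENNReal.ofReal (ρ x)) hρ.measurable.ennreal_ofReal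
    (fun x => by rw [← ENNReal.ofReal_mul (hρ0 x).le, hρJ, ENNReal.ofReal_one])
    hh.measurable.ennreal_ofReal hinv
  have hp : ∀ x, 0 ≤ ρ x * h x := fun x => mul_nonneg (hρ0 x).le (hh0 x)
  -- An almost everywhere equality of continuous functions holds on a closed set of full measure,
  -- which contains the support.
  have hsub : m.support ⊆ {y | fibreSum f (fun x => ρ x * h x) y = h y} := by
    refine Measure.support_subset_of_isClosed
      (isClosed_eq (continuous_fibreSum hf (hρ.mul hh)) hh) ?_
    filter_upwards [hae] with y hy
    simp only [← ENNReal.ofReal_mul (hρ0 _).le] at hy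
    rw [tsum_fibre_ofReal hf hp] at hy
    refine ((ENNReal.ofReal_eq_ofReal_iff (hh0 y) ?_).1 hy).symm
    rw [fibreSum_eq_sum hf]
    exact Finset.sum_nonneg fun x _ => hp x
  exact hsub

end Marginal

/-! ### Invariant probabilities with continuous density. -/

section Density

variable {M : Type*} [MetricSpace M]

/-- The weight of `CondF3` is positive and continuous, with ratios bounded by `exp ε`. -/
theorem CondF3.weight [CompactSpace M] [Nonempty M] {ζ : ℝ≥0} (hζ : 0 < ζ) {ρ : M → ℝ} {ε : ℝ}
    (hε : 0 < ε) (h : CondF3 ζ ρ ε) (hρ0 : ∀ x, 0 ≤ ρ x) :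
    Continuous ρ ∧ (∀ x, 0 < ρ x) ∧ ∀ x y, ρ x ≤ Real.exp ε * ρ y := by
  obtain ⟨hlog, hH⟩ := h
  -- The strict bound on the Hölder seminorm would fail if `ε * inf ρ` were not positive.
  have hinf : 0 < ⨅ x, ρ x := by
    have := ENNReal.ofReal_pos.1 (zero_le.trans_lt hH)
    exact pos_of_mul_pos_right this hε.le
  have hbdd : BddBelow (range ρ) := ⟨0, by rintro _ ⟨x, rfl⟩; exact hρ0 x⟩
  have hpos : ∀ x, 0 < ρ x := fun x => hinf.trans_le (ciInf_le hbdd x)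
  have hcont : Continuous ρ := by
    have hmem : MemHolder ζ ρ := eHolderNorm_lt_top.1 (hH.trans ENNReal.ofReal_lt_top)
    exact hmem.holderWith.continuous hζ
  have hlogc : Continuous fun x => Real.log (ρ x) := hcont.log fun x => (hpos x).ne'
  have hcomp := isCompact_range hlogc
  refine ⟨hcont, hpos, fun x y => ?_⟩
  have h1 := le_ciSup hcomp.bddAbove x
  have h2 := ciInf_le hcomp.bddBelow y
  have h3 : Real.log (ρ x) ≤ ε + Real.log (ρ y) := by linarith
  calc ρ x = Real.exp (Real.log (ρ x)) := (Real.exp_log (hpos x)).symm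
    _ ≤ Real.exp (ε + Real.log (ρ y)) := Real.exp_le_exp.2 h3
    _ = Real.exp ε * ρ y := by rw [Real.exp_add, Real.exp_log (hpos y)]

variable [MeasurableSpace M] [BorelSpace M]

theorem CondF2.exists_cover [Nonempty M] {f : M → M} {A : Set M} {q : ℕ} (h : CondF2 f A q) :
    ∃ U : ℕ → Set M, (∀ n, MeasurableSet (U n)) ∧ (∀ n, InjOn f (U n)) ∧ ⋃ n, U n = univ := by
  obtain ⟨-, 𝒰, hU, hcov, -⟩ := h
  have hne : (𝒰 : Set (Set M)).Nonempty := by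
    obtain ⟨x⟩ := ‹Nonempty M›
    obtain ⟨U, hU', -⟩ := mem_iUnion₂.1 (hcov.ge (mem_univ x))
    exact ⟨U, hU'⟩
  obtain ⟨V, hV⟩ := 𝒰.countable_toSet.exists_eq_range hne
  have hmem : ∀ n, V n ∈ 𝒰 := fun n => by
    have : V n ∈ (𝒰 : Set (Set M)) := hV ▸ mem_range_self n
    exact this
  refine ⟨V, fun n => (hU _ (hmem n)).1.measurableSet, fun n => (hU _ (hmem n)).2, ?_⟩
  refine eq_univ_of_forall fun x => ?_
  obtain ⟨U, hU', hx⟩ := mem_iUnion₂.1 (hcov.ge (mem_univ x))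
  obtain ⟨n, rfl⟩ : U ∈ range V := hV ▸ hU'
  exact mem_iUnion.2 ⟨n, hx⟩

/-- An absolutely continuous invariant probability of the base map whose density has a continuous
version is the reference measure. -/
theorem eq_of_continuous_density [CompactSpace M] [ConnectedSpace M] {ζ : ℝ≥0} (hζ0 : 0 < ζ)
    (hζ1 : ζ ≤ 1) {f : M → M} (hf : IsLocalHomeomorph f)
    (hlen : ∀ (C : ℝ≥0) (h : M → ℝ),
      (∀ y, ∃ V ∈ 𝓝 y, ∀ a ∈ V, ∀ b ∈ V, edist (h a) (h b) ≤ C * edist a b) → LipschitzWith C h)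
    {m : Measure M} [IsProbabilityMeasure m] (hm : MeasurePreserving f m m)
    {J : M → ℝ} (hJ : IsJacobian f m J) {L : M → ℝ} (hL : LocalInverseLipschitz f L)
    {A : Set M} {σ Λ ε : ℝ} {q : ℕ}
    (hσ : 1 < σ) (hΛ1 : 1 ≤ Λ) (hΛ2 : Λ ≤ 2) (hε : 0 < ε)
    (hf1 : CondF1 L A σ Λ) (hf2 : CondF2 f A q) (hf3 : CondF3 ζ (fun x => 1 / |J x|) ε)
    (hconst : CondConstants ζ (mapDegree f) q σ Λ ε)
    {η : Measure M} [IsProbabilityMeasure η] (hη : η.map f = η) (hac : η ≪ m)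
    {h : M → ℝ} (hh : Continuous h) (hdens : (fun x => (η.rnDeriv m x).toReal) =ᵐ[m] h) :
    η = m := by
  obtain ⟨hρc, hρ0, hρr⟩ := hf3.weight hζ0 hε fun x => by positivity
  -- At a zero of `J` the convention `1 / 0 = 0` would give weight zero, contradicting positivity.
  have hρJ : ∀ x, 1 / |J x| * J x = 1 := fun x => by
    have h0 : J x ≠ 0 := fun h0 => by simpa [h0] using hρ0 x
    rw [abs_of_nonneg (hJ.nonneg x), one_div_mul_cancel h0]
  generalize hρdef : (fun x => 1 / |J x|) = ρ at hρc hρ0 hρr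
  replace hρJ : ∀ x, ρ x * J x = 1 := fun x => by rw [← hρdef]; exact hρJ x
  replace hρ0 : ∀ x, 0 < ρ x := fun x => by rw [← hρdef]; exact hρ0 x
  replace hρr : ∀ x y, ρ x ≤ Real.exp ε * ρ y := fun x y => by rw [← hρdef]; exact hρr x y
  obtain ⟨U, hUm, hUi, hUc⟩ := hf2.exists_cover
  have hd : (0 : ℝ) < mapDegree f := by exact_mod_cast (Nat.zero_le q).trans_lt hf2.1
  have hqd : (0 : ℝ) ≤ mapDegree f - q := sub_nonneg.2 (by exact_mod_cast hf2.1.le)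
  -- the weights add up to one
  have hρ1 : ∀ y ∈ m.support, fibreSum f ρ y = 1 := by
    have := hJ.fibreSum_eq_on_support hf hUm hUi hUc hρc hρ0 hρJ (h := fun _ => 1)
      continuous_const (fun _ => zero_le_one) (by simpa using hm.map_eq)
    simpa using this
  have hSne : m.support.Nonempty := Measure.nonempty_support (IsProbabilityMeasure.ne_zero m)
  -- Comparing `ρ x` with each of the `d` weights on one fibre, whose sum is one, gives `d * ρ x ≤
  -- e^ε`.
  have hr : ∀ x, ρ x ≤ Real.exp ε / mapDegree f := by
    intro x
    obtain ⟨y, hy⟩ := hSne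
    rw [le_div_iff₀ hd]
    have e := hρ1 y hy
    rw [fibreSum_eq_sum hf] at e
    have hcard : ((finite_fibre hf y).toFinset.card : ℝ) = mapDegree f := by
      rw [← ncard_fibre_eq_mapDegree hf y, Set.ncard_eq_toFinset_card _ (finite_fibre hf y)]
    calc ρ x * mapDegree f = ∑ _x' ∈ (finite_fibre hf y).toFinset, ρ x := by
          rw [Finset.sum_const, nsmul_eq_mul, hcard, mul_comm]
      _ ≤ ∑ x' ∈ (finite_fibre hf y).toFinset, Real.exp ε * ρ x' :=
          Finset.sum_le_sum fun x' _ => hρr x x'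
      _ = Real.exp ε := by rw [← Finset.mul_sum, e, mul_one]
  let c : ℝ≥0 := ⟨((mapDegree f : ℝ) - q) * σ⁻¹ + q * Λ, by positivity⟩
  have hLip : ∀ u : M → ℝ, LipschitzWith 1 u → LipschitzWith c (fibreSum f u) := fun u hu =>
    hlen c _ fun y => edist_fibreSum_le (c := c) hf hL
      (fun y => fibreSum_max_le hf hσ hΛ1 hf1 hf2 y) hu y
  have hrc : Real.exp ε / mapDegree f * c < 1 := hconst.linear hζ1 hf2.1.le hσ hΛ1 hΛ2
  -- the density
  let k : M → ℝ := fun x => max (h x) 0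
  have hηk : η = m.withDensity fun x => ENNReal.ofReal (k x) := by
    rw [← Measure.withDensity_rnDeriv_eq η m hac]
    refine withDensity_congr_ae ?_
    filter_upwards [hdens, Measure.rnDeriv_lt_top η m] with x hx hx'
    rw [← ENNReal.ofReal_toReal hx'.ne, hx]
    simp [k, ENNReal.ofReal_max]
  have hkc : Continuous k := hh.max continuous_const
  obtain ⟨a, ha⟩ := eqOn_const_of_fixed hf hρ0 Measure.isClosed_support hSne
    (hJ.preimage_support_subset hf) hρ1 hLip hr hrc hkc
    (hJ.fibreSum_eq_on_support hf hUm hUi hUc hρc hρ0 hρJ hkc (fun x => le_max_right _ _)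
      (by rw [← hηk, hη]))
  have hηa : η = ENNReal.ofReal a • m := by
    rw [hηk, ← withDensity_const]
    refine withDensity_congr_ae ?_
    filter_upwards [Measure.support_mem_ae] with x hx
    rw [ha x hx]
  have h1 : ENNReal.ofReal a = 1 := by
    have := congrArg (fun κ : Measure M => κ univ) hηa
    simpa using this.symm
  rw [hηa, h1, one_smul]

end Density

/-! ### Positive measures as elements of `S^∞`. -/

section Positive

variable {X : Type*} [MeasurableSpace X]

theorem toJordanDecomposition_toSignedMeasure (μ : Measure X) [IsFiniteMeasure μ] :
    μ.toSignedMeasure.toJordanDecomposition.posPart = μ ∧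
      μ.toSignedMeasure.toJordanDecomposition.negPart = 0 := by
  have h := Measure.toJordanDecomposition_toSignedMeasure_sub (μ := μ) (ν := 0)
  rw [Measure.toSignedMeasure_zero, sub_zero] at h
  rw [h]
  exact ⟨Measure.sub_zero, Measure.zero_sub⟩

variable {M K : Type*} [MeasurableSpace M] [MeasurableSpace K]

theorem marginalDensity_toSignedMeasure (m : Measure M) [SigmaFinite m] (μ : Measure (M × K))
    [IsFiniteMeasure μ] :
    marginalDensity m μ.toSignedMeasure =ᵐ[m] fun x => (μ.fst.rnDeriv m x).toReal := by
  obtain ⟨hp, hn⟩ := toJordanDecomposition_toSignedMeasure μ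
  have h0 : (negM μ.toSignedMeasure).fst.rnDeriv m =ᵐ[m] 0 := by
    rw [negM, hn, Measure.fst_zero]
    exact Measure.rnDeriv_zero m
  filter_upwards [h0] with x hx
  rw [marginalDensity, hx, posM, hp]
  simp

/-- A probability on the product whose marginal is `m` belongs to `S^∞`. -/
theorem mem_SInfty_of_fst_eq [MetricSpace M] [MetricSpace K] [StandardBorelSpace K] [Nonempty K]
    {m : Measure M} [IsProbabilityMeasure m] (ζ : ℝ≥0) (μ : Measure (M × K))
    [IsProbabilityMeasure μ] (hμ : μ.fst = m) : μ.toSignedMeasure ∈ SInfty m ζ := by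
  obtain ⟨hp, hn⟩ := toJordanDecomposition_toSignedMeasure μ
  have hpf : (posM μ.toSignedMeasure).fst = m := by rw [posM, hp, hμ]
  have hnf : (negM μ.toSignedMeasure).fst = 0 := by rw [negM, hn, Measure.fst_zero]
  refine ⟨⟨⟨?_, ?_⟩, ?_⟩, fun _ => 1, ⟨0, HolderWith.const⟩, ?_⟩
  · rw [hpf]
  · rw [hnf]; exact Measure.AbsolutelyContinuous.zero _
  -- The negative part is zero and almost every fibre carries a probability, so testing against `|g|
  -- ≤ 1` gives at most `1`.
  · refine lt_of_le_of_lt (essSup_le_of_ae_le 1 ?_) ENNReal.one_lt_top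
    have h1 : (posM μ.toSignedMeasure).fst.rnDeriv m =ᵐ[m] fun _ => 1 := by
      rw [hpf]; exact Measure.rnDeriv_self m
    have h0 : (negM μ.toSignedMeasure).fst.rnDeriv m =ᵐ[m] 0 := by
      rw [hnf]; exact Measure.rnDeriv_zero m
    filter_upwards [h1, h0] with x hx1 hx0
    refine iSup_le fun g => iSup_le fun _ => iSup_le fun hg => ?_
    rw [fibreRestriction, fibreRestriction, hx1, hx0, Pi.zero_apply, zero_smul, one_smul,
      integral_zero_measure, sub_zero]
    have hle := norm_integral_le_of_norm_le_const (C := 1)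
      (μ := (posM μ.toSignedMeasure).condKernel x) (f := g) (ae_of_all _ hg)
    rw [probReal_univ, mul_one] at hle
    exact ENNReal.ofReal_le_one.2 hle
  · refine (marginalDensity_toSignedMeasure m μ).trans ?_
    rw [hμ]
    filter_upwards [Measure.rnDeriv_self m] with x hx
    simp [hx]

end Positive

end SkewProduct

end

/-! ### The main theorem. -/

theorem theoremA
    -- a compact connected Riemannian manifold `M` with its Riemannian distance
    {E : Type*} [NormedAddCommGroup E] [InnerProductSpace ℝ E] [FiniteDimensional ℝ E]
    {M : Type*} [MetricSpace M] [ChartedSpace E M] [IsManifold 𝓘(ℝ, E) ∞ M]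
    [Bundle.RiemannianBundle (fun x : M => TangentSpace 𝓘(ℝ, E) x)]
    [IsContMDiffRiemannianBundle 𝓘(ℝ, E) ∞ E (fun x : M => TangentSpace 𝓘(ℝ, E) x)]
    [IsRiemannianManifold 𝓘(ℝ, E) M]
    [CompactSpace M] [ConnectedSpace M] [MeasurableSpace M] [BorelSpace M]
    -- a compact metric space `K`
    {K : Type*} [MetricSpace K] [CompactSpace K] [Nonempty K] [MeasurableSpace K] [BorelSpace K]
    -- the Hölder exponent
    (ζ : ℝ≥0) (hζ0 : 0 < ζ) (hζ1 : ζ ≤ 1)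
    -- the base map and its invariant probability `m₁`, with Jacobian `J`
    (f : M → M) (hf : IsLocalDiffeomorph 𝓘(ℝ, E) 𝓘(ℝ, E) 1 f)
    (m₁ : Measure M) [IsProbabilityMeasure m₁] (hm₁ : MeasurePreserving f m₁ m₁)
    (J : M → ℝ) (hJ : SkewProduct.IsJacobian f m₁ J)
    -- the hypotheses on `f`, where `Λ` is the constant bounding `L` on `A`
    (L : M → ℝ) (hLcont : Continuous L) (hL : SkewProduct.LocalInverseLipschitz f L)
    (A : Set M) (hA : IsOpen A) (σ Λ ε : ℝ) (q : ℕ)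
    (hσ : 1 < σ) (hΛ1 : 1 ≤ Λ) (hΛ2 : Λ ≤ 2) (hε : 0 < ε)
    (hf1 : SkewProduct.CondF1 L A σ Λ)
    (hf2 : SkewProduct.CondF2 f A q)
    (hf3 : SkewProduct.CondF3 ζ (fun x => 1 / |J x|) ε)
    (hconst : SkewProduct.CondConstants ζ (SkewProduct.mapDegree f) q σ Λ ε)
    -- the fibre map
    (G : M × K → K) (hG : Measurable G) (hG1 : SkewProduct.CondG1 m₁ G) :
    ∃ μ₀ : ProbabilityMeasure (M × K),
      (MeasurePreserving (SkewProduct.skew f G) (μ₀ : Measure (M × K)) (μ₀ : Measure (M × K)) ∧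
        (μ₀ : Measure (M × K)).toSignedMeasure ∈ SkewProduct.SInfty m₁ ζ) ∧
      (∀ ν : ProbabilityMeasure (M × K),
        MeasurePreserving (SkewProduct.skew f G) (ν : Measure (M × K)) (ν : Measure (M × K)) →
        (ν : Measure (M × K)).toSignedMeasure ∈ SkewProduct.SInfty m₁ ζ → ν = μ₀) ∧
      Measure.map Prod.fst (μ₀ : Measure (M × K)) = m₁ := by
  have hfm : Measurable f := hm₁.measurable
  have hfl : IsLocalHomeomorph f := hf.isLocalHomeomorph
  obtain ⟨G', α, hG'm, hα0, hα1, hG', hGG'⟩ := hG1.exists_contract hG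
  obtain ⟨μ₀, hμ₀, hμ₀f⟩ := SkewProduct.exists_measurePreserving_skew hm₁ hG'm hα0 hα1 hG'
  refine ⟨μ₀, ⟨⟨SkewProduct.measurable_skew hfm hG, ?_⟩,
    SkewProduct.mem_SInfty_of_fst_eq ζ _ hμ₀f⟩, fun ν hν hνS => ?_, hμ₀f⟩
  · rw [← Measure.map_congr (SkewProduct.skew_ae_eq hμ₀f hGG'), hμ₀.map_eq]
  -- Once the marginal is known to be `m₁`, `G` and `G'` agree almost everywhere for `ν`, and
  -- uniqueness over a fixed marginal applies.
  · have hνf : (ν : Measure (M × K)).fst = m₁ := by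
      obtain ⟨⟨⟨hac, -⟩, -⟩, h, ⟨C, hC⟩, hdens⟩ := hνS
      rw [SkewProduct.posM, (SkewProduct.toJordanDecomposition_toSignedMeasure _).1] at hac
      refine SkewProduct.eq_of_continuous_density hζ0 hζ1 hfl
        (fun C h hloc => SkewProduct.lipschitzWith_of_locally E hloc) hm₁ hJ hL hσ hΛ1 hΛ2 hε
        hf1 hf2 hf3 hconst ?_ hac (hC.continuous hζ0)
        ((SkewProduct.marginalDensity_toSignedMeasure m₁ _).symm.trans hdens)
      rw [← SkewProduct.fst_map_skew hfm hG, hν.map_eq]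
    have hν' : MeasurePreserving (SkewProduct.skew f G') (ν : Measure (M × K)) ν :=
      ⟨SkewProduct.measurable_skew hfm hG'm, by
        rw [Measure.map_congr (SkewProduct.skew_ae_eq hνf hGG'), hν.map_eq]⟩
    exact Subtype.ext (SkewProduct.eq_of_measurePreserving_skew hfm hG'm hα0 hα1 hG'
      (ν : Measure (M × K)) (μ₀ : Measure (M × K)) (hνf.trans hμ₀f.symm) hν' hμ₀)
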